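/- Let $X$ be a random vector in $\mathbb{R}^n$ with density $f$ (with respect to Lebesgue measure) whose distribution $\mu$ is $\kappa$-concave for a real number $\kappa$ (necessarily $-1\le\kappa<0$ under the condition below), that is, $$\mu(tA+(1-t)B)\ \ge\ \bigl[t\,\mu(A)^{\kappa}+(1-t)\,\mu(B)^{\kappa}\bigr]^{1/\kappa}$$ for all $t\in(0,1)$ and all Borel sets $A,B\subset\mathbb{R}^n$ of positive measure, where $tA+(1-t)B=\{tx+(1-t)y: x\in A,\ y\in B\}$. Suppose that $\beta=n-\frac1\kappa\ge n+1$. Then $f\log f$ is Lebesgue integrable and $f\in L^2(\mathbb{R}^n)$, so that the Shannon entropy $h(X)=-\int_{\mathbb{R}^n} f\log f\,dx$ and the Rényi entropy of order two $h_2(X)=-\log\int_{\mathbb{R}^n} f^2\,dx$ are finite, and $$h_2(X)\ \le\ h(X)\ \le\ h_2(X)+\beta\sum_{i=1}^n\frac{1}{\beta-i}.$$ Moreover, $h_2(X)$ is given by the characteristic function $\varphi(t)=\mathbb{E}\,e^{i\langle t,X\rangle}$ of $X$: $\varphi\in L^2(\mathbb{R}^n)$ and $$h_2(X)=n\log(2\pi)-\log\int_{\mathbb{R}^n}|\varphi(t)|^2\,dt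 .$$ -/

import Mathlib

open MeasureTheory ProbabilityTheory
open scoped ENNReal Pointwise

noncomputable section

/-- The weighted power mean `[t a^κ + (1-t) b^κ]^(1/κ)` of two positive numbers, read as the
weighted geometric mean `a^t b^(1-t)` when `κ = 0`. -/
def powerMean (κ t a b : ℝ) : ℝ :=
  if κ = 0 then a ^ t * b ^ (1 - t) else (t * a ^ κ + (1 - t) * b ^ κ) ^ (1 / κ)

/-- A measure `μ` on `ℝⁿ` is `κ`-concave (for a real number `κ`) if
`μ(tA + (1-t)B) ≥ [t μ(A)^κ + (1-t) μ(B)^κ]^(1/κ)` for all `t ∈ (0,1)` and all Borel sets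
`A`, `B` of positive measure; `t • A + (1 - t) • B` is the Minkowski sum. (The Minkowski sum of
Borel sets is analytic, hence universally measurable, and its value under the outer measure of `μ`
is its value under the completion of `μ`.) -/
def IsKappaConcave {n : ℕ} (κ : ℝ) (μ : Measure (EuclideanSpace ℝ (Fin n))) : Prop :=
  ∀ t : ℝ, 0 < t → t < 1 →
    ∀ A B : Set (EuclideanSpace ℝ (Fin n)), MeasurableSet A → MeasurableSet B →
      0 < μ A → 0 < μ B →
        powerMean κ t (μ.real A) (μ.real B) ≤ μ.real (t • A + (1 - t) • B)

/-- The probability density of a random vector in `ℝⁿ` with respect to Lebesgue measure,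
as a real-valued function. -/
def density {Ω : Type*} [MeasurableSpace Ω] {n : ℕ} (P : Measure Ω)
    (X : Ω → EuclideanSpace ℝ (Fin n)) (x : EuclideanSpace ℝ (Fin n)) : ℝ :=
  (pdf X P volume x).toReal

/-- The Shannon differential entropy `h(X) = -∫ f log f`, meaningful when `f log f` is
Lebesgue integrable. -/
def diffEntropy {Ω : Type*} [MeasurableSpace Ω] {n : ℕ} (P : Measure Ω)
    (X : Ω → EuclideanSpace ℝ (Fin n)) : ℝ :=
  -∫ x, density P X x * Real.log (density P X x)

/-- The Rényi entropy of order `p > 1`: `h_p(X) = (p / (p - 1)) log (1 / ‖f‖_p)` with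
`‖f‖_p = (∫ f^p)^(1/p)`, meaningful when `f ∈ L^p`. -/
def renyiEntropy {Ω : Type*} [MeasurableSpace Ω] {n : ℕ} (p : ℝ) (P : Measure Ω)
    (X : Ω → EuclideanSpace ℝ (Fin n)) : ℝ :=
  p / (p - 1) * Real.log (1 / (∫ x, density P X x ^ p) ^ (1 / p))

end

/-! The density `f` is compared with the extremal density `(1 + ‖x‖)^(-β)` through volumes of level
sets. Concavity tested on small balls makes `f^(-1/β)` essentially convex. Contracting superlevel
sets toward a point where `f` is essentially at least `M` shows that `|{f ≥ M y}| / (y^(-1/β) -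
1)^n` is nondecreasing in `y` (`IsKappaConcave.volume_superlevel_mul_le`). A single-crossing
argument (`integral_neg_log_mul_le`) and the layer-cake formula then bound the entropy of `min (f /
M) 1` for every `M` below the essential supremum (`integral_neg_truncation_mul_log_le`).

With `C = β ∑ 1/(β-i)` these bounds first force `f` to be bounded and `f log f` integrable, and then
give `log M + h ≤ C`. Hence `f ≤ e^(C-h)` almost everywhere and `∫ f² ≤ e^(C-h)`, which is the upper
bound. The lower bound is Jensen's inequality for `log`, and the formula for `h_2` is Plancherel's
theorem. -/

/-! ### A logarithmic Beta integral. -/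

/-- A primitive of `w^(p-1) (1-w)^n (∑_{j ≤ n} 1/(p+j) + log w)`, vanishing at `0` and at `1`. -/
noncomputable def betaLogPrimitive : ℕ → ℝ → ℝ → ℝ
  | 0, p, w => w ^ p * Real.log w / p
  | n + 1, p, w =>
      (1 - w) ^ (n + 1) * (w ^ p * (∑ j ∈ Finset.range (n + 1), 1 / (p + 1 + j) + Real.log w)) / p
        + (n + 1) / p * betaLogPrimitive n (p + 1) w

lemma continuousOn_rpow_mul_log {p : ℝ} (hp : 0 < p) :
    ContinuousOn (fun w : ℝ => w ^ p * Real.log w) (Set.Icc 0 1) := by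
  intro w hw
  rcases hw.1.eq_or_lt with rfl | h0
  · have h := tendsto_log_mul_rpow_nhdsGT_zero hp
    have h2 : ContinuousWithinAt (fun w : ℝ => w ^ p * Real.log w) (Set.Ioi 0) 0 := by
      have e : (0 : ℝ) ^ p * Real.log 0 = 0 := by simp
      rw [ContinuousWithinAt, e]
      exact h.congr fun x => mul_comm _ _
    rw [← continuousWithinAt_insert_self, Set.Ioi_insert] at h2
    exact h2.mono Set.Icc_subset_Ici_self
  · exact ((Real.continuousAt_rpow_const _ _ (Or.inl h0.ne')).mul
      (Real.continuousAt_log h0.ne')).continuousWithinAt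

lemma continuousOn_betaLogPrimitive (n : ℕ) : ∀ {p : ℝ}, 0 < p →
    ContinuousOn (betaLogPrimitive n p) (Set.Icc 0 1) := by
  induction n with
  | zero => intro p hp; exact (continuousOn_rpow_mul_log hp).div_const p
  | succ n ih =>
    intro p hp
    refine ContinuousOn.add ?_ (continuousOn_const.mul (ih (by linarith)))
    refine ContinuousOn.div_const (ContinuousOn.mul (by fun_prop) ?_) p
    simp_rw [mul_add]
    exact ((Real.continuous_rpow_const hp.le).continuousOn.mul continuousOn_const).add
      (continuousOn_rpow_mul_log hp)

lemma betaLogPrimitive_zero_right (n : ℕ) : ∀ {p : ℝ}, 0 < p → betaLogPrimitive n p 0 = 0 := by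
  induction n with
  | zero => intro p hp; simp [betaLogPrimitive]
  | succ n ih => intro p hp; simp [betaLogPrimitive, ih (by linarith : 0 < p + 1), hp.ne']

lemma betaLogPrimitive_one_right (n : ℕ) : ∀ {p : ℝ}, betaLogPrimitive n p 1 = 0 := by
  induction n with
  | zero => intro p; simp [betaLogPrimitive]
  | succ n ih => intro p; simp [betaLogPrimitive, ih]

/-- The recursion is integration by parts: differentiating `(1-w)^(n+1)` leaves a multiple of the
integrand for `(n, p+1)`, which the recursive term cancels. -/
lemma hasDerivAt_betaLogPrimitive (n : ℕ) : ∀ {p w : ℝ}, 0 < p → 0 < w →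
    HasDerivAt (betaLogPrimitive n p)
      (w ^ (p - 1) * (1 - w) ^ n * (∑ j ∈ Finset.range (n + 1), 1 / (p + j) + Real.log w)) w := by
  induction n with
  | zero =>
    intro p w hp hw
    have h := ((Real.hasDerivAt_rpow_const (p := p) (Or.inl hw.ne')).mul
      (Real.hasDerivAt_log hw.ne')).div_const p
    refine h.congr_deriv ?_
    have e : w ^ p = w ^ (p - 1) * w := by
      rw [← Real.rpow_add_one hw.ne']; ring_nf
    rw [e]
    field_simp
    simp
    field_simp
    ring
  | succ n ih =>
    intro p w hp hw
    have h1 : HasDerivAt (fun w : ℝ => (1 - w) ^ (n + 1)) (((n + 1 : ℕ) : ℝ) * (1 - w) ^ n * (-1)) w := by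
      simpa using ((hasDerivAt_id w).const_sub 1).fun_pow (n + 1)
    have h2 := ((Real.hasDerivAt_rpow_const (p := p) (Or.inl hw.ne')).mul
      ((Real.hasDerivAt_log hw.ne').const_add (∑ j ∈ Finset.range (n + 1), 1 / (p + 1 + j))))
    have h := ((h1.mul h2).div_const p).add ((ih (by linarith : 0 < p + 1) hw).const_mul ((n + 1) / p))
    refine h.congr_deriv ?_
    have e : w ^ p = w ^ (p - 1) * w := by
      rw [← Real.rpow_add_one hw.ne']; ring_nf
    have e2 : w ^ (p + 1 - 1) = w ^ (p - 1) * w := by rw [← e]; ring_nf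
    rw [e2, Finset.sum_range_succ' _ (n + 1)]
    have e3 : ∀ j : ℕ, 1 / (p + ((j + 1 : ℕ) : ℝ)) = 1 / (p + 1 + j) := fun j => by
      push_cast; ring_nf
    simp_rw [e3]
    generalize ∑ j ∈ Finset.range (n + 1), 1 / (p + 1 + (j : ℝ)) = S
    simp only [Pi.mul_apply, e]
    push_cast
    field_simp
    ring

/-! ### The extremal profile and the single-crossing comparison. -/

/-- The level-set profile `(y^(-1/β) - 1)^n` of the extremal density `(1 + ‖x‖)^(-β)`. -/
noncomputable def extremalProfile (n : ℕ) (β y : ℝ) : ℝ := (y ^ (-1 / β) - 1) ^ n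

/-- The constant `β ∑_{i ≤ n} 1/(β-i)`. -/
noncomputable def entropyConst (n : ℕ) (β : ℝ) : ℝ := β * ∑ i ∈ Finset.range (n + 1), 1 / (β - i)

section
variable {n : ℕ} {β : ℝ}

lemma extremalProfile_nonneg (hβ : 0 < β) {y : ℝ} (hy : 0 < y) (hy1 : y ≤ 1) :
    0 ≤ extremalProfile n β y := by
  refine pow_nonneg (sub_nonneg.2 ?_) n
  exact Real.one_le_rpow_of_pos_of_le_one_of_nonpos hy hy1
    (div_nonpos_of_nonpos_of_nonneg (by norm_num) hβ.le)

lemma extremalProfile_pos (hβ : 0 < β) {y : ℝ} (hy : 0 < y) (hy1 : y < 1) :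
    0 < extremalProfile n β y := by
  refine pow_pos (sub_pos.2 ?_) n
  exact Real.one_lt_rpow_of_pos_of_lt_one_of_neg hy hy1
    (div_neg_of_neg_of_pos (by norm_num) hβ)

lemma extremalProfile_le (hβ : 0 < β) {y : ℝ} (hy : 0 < y) (hy1 : y ≤ 1) :
    extremalProfile n β y ≤ y ^ (-(n / β)) := by
  have h1 : 1 ≤ y ^ (-1 / β) := Real.one_le_rpow_of_pos_of_le_one_of_nonpos hy hy1
    (div_nonpos_of_nonpos_of_nonneg (by norm_num) hβ.le)
  calc extremalProfile n β y ≤ (y ^ (-1 / β)) ^ n :=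
        pow_le_pow_left₀ (by linarith) (by linarith) n
    _ = y ^ (-(n / β)) := by
        rw [← Real.rpow_mul_natCast hy.le]; congr 1; ring

lemma continuousOn_extremalProfile : ContinuousOn (extremalProfile n β) (Set.Ioc 0 1) := by
  intro y hy
  exact (((Real.continuousAt_rpow_const _ _ (Or.inl hy.1.ne')).sub
    continuousAt_const).pow n).continuousWithinAt

lemma integrableOn_extremalProfile (hn : n < β) :
    IntegrableOn (extremalProfile n β) (Set.Ioc 0 1) := by
  have hβ : 0 < β := lt_of_le_of_lt (Nat.cast_nonneg n) hn
  have hi : IntegrableOn (fun y : ℝ => y ^ (-(n / β))) (Set.Ioc 0 1) := by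
    rw [← intervalIntegrable_iff_integrableOn_Ioc_of_le zero_le_one]
    refine intervalIntegral.intervalIntegrable_rpow' ?_
    rw [neg_lt_neg_iff, div_lt_one hβ]; exact hn
  refine Integrable.mono' hi
    (continuousOn_extremalProfile.aestronglyMeasurable measurableSet_Ioc) ?_
  filter_upwards [ae_restrict_mem measurableSet_Ioc] with y hy
  rw [Real.norm_of_nonneg (extremalProfile_nonneg hβ hy.1 hy.2)]
  exact extremalProfile_le hβ hy.1 hy.2

lemma integrableOn_log_mul_extremalProfile (hn : n < β) :
    IntegrableOn (fun y => Real.log y * extremalProfile n β y) (Set.Ioc 0 1) := by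
  have hβ : 0 < β := lt_of_le_of_lt (Nat.cast_nonneg n) hn
  have hq : n / β < 1 := (div_lt_one hβ).2 hn
  -- Half the gap to exponent `-1`: the factor `y^(-ε)` absorbs the logarithm and `-(n/β) - ε > -1`
  -- still holds.
  set ε : ℝ := (1 - n / β) / 2 with hε
  have hε0 : 0 < ε := by rw [hε]; linarith
  have hi : IntegrableOn (fun y : ℝ => 1 / ε * y ^ (-(n / β) - ε)) (Set.Ioc 0 1) := by
    refine Integrable.const_mul ?_ _
    change IntegrableOn _ _ _
    rw [← intervalIntegrable_iff_integrableOn_Ioc_of_le zero_le_one]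
    refine intervalIntegral.intervalIntegrable_rpow' ?_
    rw [hε]; linarith
  refine Integrable.mono' hi (ContinuousOn.aestronglyMeasurable ?_ measurableSet_Ioc) ?_
  · exact (Real.continuousOn_log.mono fun y hy => hy.1.ne').mul continuousOn_extremalProfile
  filter_upwards [ae_restrict_mem measurableSet_Ioc] with y hy
  have h1 := (Real.abs_log_mul_self_rpow_lt y ε hy.1 hy.2 hε0).le
  have h2 : Real.log y * extremalProfile n β y
      = (Real.log y * y ^ ε) * (y ^ (-ε) * extremalProfile n β y) := by
    have : y ^ ε * y ^ (-ε) = 1 := by rw [← Real.rpow_add hy.1]; simp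
    linear_combination (-Real.log y * extremalProfile n β y) * this
  have h3 : 0 ≤ y ^ (-ε) * extremalProfile n β y :=
    mul_nonneg (Real.rpow_nonneg hy.1.le _) (extremalProfile_nonneg hβ hy.1 hy.2)
  rw [h2, Real.norm_eq_abs, abs_mul, abs_of_nonneg h3]
  refine mul_le_mul h1 ?_ h3 (by positivity)
  calc y ^ (-ε) * extremalProfile n β y ≤ y ^ (-ε) * y ^ (-(n / β)) :=
        mul_le_mul_of_nonneg_left (extremalProfile_le hβ hy.1 hy.2) (Real.rpow_nonneg hy.1.le _)
    _ = y ^ (-(n / β) - ε) := by rw [← Real.rpow_add hy.1]; ring_nf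

/-- The substitution `w = y^(1/β)` turns this into the Beta integral above with `p = β - n`. It
identifies `-entropyConst n β` as the mean of `log y` under the extremal profile. -/
lemma integral_log_mul_extremalProfile (hn : n < β) :
    ∫ y in (0 : ℝ)..1, (entropyConst n β + Real.log y) * extremalProfile n β y = 0 := by
  have hβ : 0 < β := lt_of_le_of_lt (Nat.cast_nonneg n) hn
  set Ψ : ℝ → ℝ := fun y => β ^ 2 * betaLogPrimitive n (β - n) (y ^ (1 / β)) with hΨ
  have hp : 0 < β - n := by linarith
  have hcont : ContinuousOn Ψ (Set.Icc 0 1) := by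
    refine continuousOn_const.mul ((continuousOn_betaLogPrimitive n hp).comp
      (Real.continuous_rpow_const (by positivity)).continuousOn fun y hy => ⟨?_, ?_⟩)
    · exact Real.rpow_nonneg hy.1 _
    · exact Real.rpow_le_one hy.1 hy.2 (by positivity)
  have hderiv : ∀ y ∈ Set.Ioo (0 : ℝ) 1, HasDerivAt Ψ
      ((entropyConst n β + Real.log y) * extremalProfile n β y) y := by
    intro y hy
    have hy0 := hy.1
    have hw : 0 < y ^ (1 / β) := Real.rpow_pos_of_pos hy0 _
    have h := ((hasDerivAt_betaLogPrimitive n hp hw).comp y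
      (Real.hasDerivAt_rpow_const (p := 1 / β) (Or.inl hy0.ne'))).const_mul (β ^ 2)
    refine h.congr_deriv ?_
    have e1 : extremalProfile n β y = (1 - y ^ (1 / β)) ^ n * y ^ (-(n / β)) := by
      have : y ^ (-1 / β) - 1 = (1 - y ^ (1 / β)) * y ^ (-1 / β) := by
        have : y ^ (1 / β) * y ^ (-1 / β) = 1 := by
          rw [← Real.rpow_add hy0, ← add_div]; simp
        linarith
      rw [extremalProfile, this, mul_pow, ← Real.rpow_mul_natCast hy0.le]
      congr 2; ring
    have e2 : (y ^ (1 / β)) ^ (β - n - 1) * y ^ (1 / β - 1) = y ^ (-(n / β)) := by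
      rw [← Real.rpow_mul hy0.le, ← Real.rpow_add hy0]
      congr 1; field_simp; ring
    have e3 : entropyConst n β = β * ∑ j ∈ Finset.range (n + 1), 1 / (β - n + j) := by
      rw [entropyConst, ← Finset.sum_range_reflect]
      congr 1
      refine Finset.sum_congr rfl fun j hj => ?_
      have : j ≤ n := by simpa [Nat.lt_succ_iff] using hj
      rw [Nat.add_sub_cancel, Nat.cast_sub this]; ring_nf
    rw [e1, e3, Real.log_rpow hy0, ← e2]
    field_simp
  rw [intervalIntegral.integral_eq_sub_of_hasDerivAt_of_le zero_le_one hcont hderiv]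
  · have : (0 : ℝ) ^ (1 / β) = 0 := Real.zero_rpow (by positivity)
    simp only [hΨ, this, Real.one_rpow, betaLogPrimitive_one_right, betaLogPrimitive_zero_right n hp]
    ring
  · rw [intervalIntegrable_iff_integrableOn_Ioc_of_le zero_le_one]
    simp_rw [add_mul]
    exact ((integrableOn_extremalProfile hn).const_mul _).add (integrableOn_log_mul_extremalProfile hn)

lemma entropyConst_pos (hn : n < β) : 0 < entropyConst n β := by
  have hβ : 0 < β := lt_of_le_of_lt (Nat.cast_nonneg n) hn
  refine mul_pos hβ (Finset.sum_pos (fun i hi => ?_) (by simp))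
  have : (i : ℝ) ≤ n := by exact_mod_cast Nat.lt_succ_iff.1 (Finset.mem_range.1 hi)
  exact one_div_pos.2 (by linarith)

/-- Among level-set profiles `D` growing relative to the extremal one, the logarithmic mean is
largest for the extremal profile. -/
theorem integral_neg_log_mul_le (hn : n < β) {D : ℝ → ℝ} (hD0 : ∀ y, 0 ≤ D y)
    (hD : AntitoneOn D (Set.Ioc 0 1))
    (hmono : ∀ y z, 0 < y → y ≤ z → z < 1 →
      D y * extremalProfile n β z ≤ D z * extremalProfile n β y) :
    IntegrableOn D (Set.Ioc 0 1) ∧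
    IntegrableOn (fun y => -Real.log y * D y) (Set.Ioc 0 1) ∧
    ∫ y in Set.Ioc 0 1, -Real.log y * D y ≤ entropyConst n β * ∫ y in Set.Ioc 0 1, D y := by
  have hβ : 0 < β := lt_of_le_of_lt (Nat.cast_nonneg n) hn
  set c := entropyConst n β with hc
  have hc0 : 0 < c := entropyConst_pos hn
  -- `c + log y` changes sign at `z`, and `K` is chosen so that `D` and `K` times the extremal
  -- profile `E` cross there.
  set z := Real.exp (-c) with hz
  have hz0 : 0 < z := Real.exp_pos _
  have hz1 : z < 1 := Real.exp_lt_one_iff.2 (by linarith)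
  have hE := extremalProfile_pos (n := n) hβ hz0 hz1
  set K := D z / extremalProfile n β z with hK
  have hK0 : 0 ≤ K := div_nonneg (hD0 z) hE.le
  have hKz : K * extremalProfile n β z = D z := div_mul_cancel₀ _ hE.ne'
  have hlow : ∀ y, 0 < y → y ≤ z → D y ≤ K * extremalProfile n β y := by
    intro y h0 h1
    rw [hK, div_mul_eq_mul_div, le_div_iff₀ hE]
    exact hmono y z h0 h1 hz1
  have hhigh : ∀ y, z ≤ y → y < 1 → K * extremalProfile n β y ≤ D y := by
    intro y h0 h1
    rw [hK, div_mul_eq_mul_div, div_le_iff₀ hE]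
    exact hmono z y hz0 h0 h1
  have hmeas : AEStronglyMeasurable D (volume.restrict (Set.Ioc 0 1)) :=
    (aemeasurable_restrict_of_antitoneOn measurableSet_Ioc hD).aestronglyMeasurable
  have i1 := (integrableOn_extremalProfile hn).const_mul K
  have i2 := (integrableOn_log_mul_extremalProfile hn).const_mul K
  have hbound : ∀ y ∈ Set.Ioc (0 : ℝ) 1, D y ≤ K * extremalProfile n β y + D z := by
    intro y hy
    rcases le_total y z with h | h
    · linarith [hlow y hy.1 h, hD0 z]
    · have := hD ⟨hz0, hz1.le⟩ hy h
      have := mul_nonneg hK0 (extremalProfile_nonneg (n := n) hβ hy.1 hy.2)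
      linarith
  have iD : IntegrableOn D (Set.Ioc 0 1) := by
    refine Integrable.mono' (i1.add (integrableOn_const (C := D z) (by simp))) hmeas ?_
    filter_upwards [ae_restrict_mem measurableSet_Ioc] with y hy
    rw [Real.norm_of_nonneg (hD0 y)]
    exact hbound y hy
  have hlog : IntegrableOn Real.log (Set.Ioc 0 1) := by
    rw [← intervalIntegrable_iff_integrableOn_Ioc_of_le zero_le_one]
    exact intervalIntegral.intervalIntegrable_log'
  have iL : IntegrableOn (fun y => -Real.log y * D y) (Set.Ioc 0 1) := by
    refine Integrable.mono' (i2.neg.add (hlog.neg.mul_const (D z)))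
      (hlog.aestronglyMeasurable.neg.mul hmeas) ?_
    filter_upwards [ae_restrict_mem measurableSet_Ioc] with y hy
    have hl : 0 ≤ -Real.log y := by
      have := Real.log_nonpos hy.1.le hy.2
      linarith
    rw [Real.norm_of_nonneg (mul_nonneg hl (hD0 y))]
    have := mul_le_mul_of_nonneg_left (hbound y hy) hl
    simp only [Pi.add_apply, Pi.neg_apply]
    linarith
  refine ⟨iD, iL, ?_⟩
  have hid := integral_log_mul_extremalProfile hn
  rw [intervalIntegral.integral_of_le zero_le_one] at hid
  -- `c + log y` and `D - K E` have the same sign on both sides of `z`, so their product is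
  -- nonnegative; the extremal side integrates to zero.
  have key : ∫ y in Set.Ioc 0 1, (-Real.log y * D y - c * D y) ≤
      ∫ y in Set.Ioc 0 1, -K * ((c + Real.log y) * extremalProfile n β y) := by
    refine integral_mono_ae (iL.sub (iD.const_mul c)) ?_ ?_
    · have := (i1.const_mul c).add i2
      refine this.neg.congr (Filter.Eventually.of_forall fun y => ?_)
      simp only [Pi.add_apply, Pi.neg_apply]
      ring
    · have h1 : ∀ᵐ y ∂(volume.restrict (Set.Ioc (0 : ℝ) 1)), y ≠ 1 :=
        ae_restrict_of_ae (Measure.ae_ne volume 1)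
      filter_upwards [ae_restrict_mem measurableSet_Ioc, h1] with y hy hy1
      rcases le_total y z with h | h
      · have h2 : Real.log y ≤ -c := by
          rw [← Real.log_exp (-c)]; exact Real.log_le_log hy.1 h
        have := mul_le_mul_of_nonneg_left (hlow y hy.1 h) (by linarith : 0 ≤ -Real.log y - c)
        linarith
      · have h2 : -c ≤ Real.log y := by
          rw [← Real.log_exp (-c)]; exact Real.log_le_log hz0 h
        have := mul_le_mul_of_nonneg_left (hhigh y h (lt_of_le_of_ne hy.2 hy1))
          (by linarith : 0 ≤ c + Real.log y)
        linarith
  rw [integral_const_mul, hid, mul_zero, integral_sub iL (iD.const_mul c), integral_const_mul] at key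
  linarith
end

/-! ### From concavity of the measure to growth of level sets. -/

section
open Filter Metric Topology

variable {n : ℕ} {β : ℝ}

/-- The points at which the lower ball density of `μ` is at least `v^(-β)`. -/
def ballLevelSet (μ : Measure (EuclideanSpace ℝ (Fin n))) (β v : ℝ) :
    Set (EuclideanSpace ℝ (Fin n)) :=
  {x | ∀ᶠ r in 𝓝[>] (0 : ℝ), v ^ (-β) * volume.real (closedBall x r) ≤ μ.real (closedBall x r)}

lemma volume_real_closedBall (x : EuclideanSpace ℝ (Fin n)) {r : ℝ} (hr : 0 ≤ r) :
    volume.real (closedBall x r) =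
      r ^ n * volume.real (closedBall (0 : EuclideanSpace ℝ (Fin n)) 1) := by
  have := Measure.addHaar_real_closedBall' (volume : Measure (EuclideanSpace ℝ (Fin n))) x hr
  rw [this, finrank_euclideanSpace_fin]

lemma volume_real_closedBall_pos :
    0 < volume.real (closedBall (0 : EuclideanSpace ℝ (Fin n)) 1) :=
  ENNReal.toReal_pos (measure_closedBall_pos volume 0 one_pos).ne' measure_closedBall_lt_top.ne

/-- For `κ < 0` both `a ↦ a^κ` and `a ↦ a^(1/κ)` are decreasing, so the two reversals cancel; the
common factor `γ` comes out by homogeneity. -/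
lemma powerMean_scaled_le {κ t a b v w γ : ℝ} (hκ : κ < 0) (ht : 0 < t) (ht1 : t < 1)
    (hv : 0 < v) (hw : 0 < w) (hγ : 0 < γ)
    (ha : v ^ (1 / κ) * γ ≤ a) (hb : w ^ (1 / κ) * γ ≤ b) :
    (t * v + (1 - t) * w) ^ (1 / κ) * γ ≤ powerMean κ t a b := by
  have aux : ∀ {v a : ℝ}, 0 < v → v ^ (1 / κ) * γ ≤ a → a ^ κ ≤ v * γ ^ κ := by
    intro v a hv ha
    have h0 : 0 < v ^ (1 / κ) * γ := mul_pos (Real.rpow_pos_of_pos hv _) hγ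
    calc a ^ κ ≤ (v ^ (1 / κ) * γ) ^ κ := Real.rpow_le_rpow_of_nonpos h0 ha hκ.le
      _ = v * γ ^ κ := by
        rw [Real.mul_rpow (Real.rpow_nonneg hv.le _) hγ.le, ← Real.rpow_mul hv.le,
          one_div_mul_cancel hκ.ne, Real.rpow_one]
  have pos : ∀ {v a : ℝ}, 0 < v → v ^ (1 / κ) * γ ≤ a → 0 < a := fun hv ha =>
    (mul_pos (Real.rpow_pos_of_pos hv _) hγ).trans_le ha
  have ht' : 0 < 1 - t := sub_pos.2 ht1
  rw [powerMean, if_neg hκ.ne]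
  have hρ : 0 < t * v + (1 - t) * w := by positivity
  calc (t * v + (1 - t) * w) ^ (1 / κ) * γ = ((t * v + (1 - t) * w) * γ ^ κ) ^ (1 / κ) := by
        rw [Real.mul_rpow hρ.le (Real.rpow_nonneg hγ.le _), ← Real.rpow_mul hγ.le,
          mul_one_div_cancel hκ.ne, Real.rpow_one]
    _ ≤ _ := by
        refine Real.rpow_le_rpow_of_nonpos ?_ ?_ (one_div_nonpos.2 hκ.le)
        · have h1 := Real.rpow_pos_of_pos (pos hv ha) κ
          have h2 := Real.rpow_pos_of_pos (pos hw hb) κ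
          positivity
        · have h1 := mul_le_mul_of_nonneg_left (aux hv ha) ht.le
          have h2 := mul_le_mul_of_nonneg_left (aux hw hb) ht'.le
          linarith

/-- Balls with radii `v s` and `w s` combine to one of radius `(t v + (1-t) w) s`. With radii
proportional to the levels, `a^(-β)` times the volume is `a^(1/κ)` times a constant, because `n - β
= 1/κ`, and this is the form the power mean preserves. -/
lemma IsKappaConcave.combo_mem_ballLevelSet {μ : Measure (EuclideanSpace ℝ (Fin n))}
    {κ : ℝ} (hμ : IsKappaConcave κ μ) (hκ : κ < 0) (hβ : β = n - 1 / κ)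
    {v w t : ℝ} (hv : 0 < v) (hw : 0 < w) (ht : 0 < t) (ht1 : t < 1)
    {x y : EuclideanSpace ℝ (Fin n)} (hx : x ∈ ballLevelSet μ β v) (hy : y ∈ ballLevelSet μ β w) :
    t • x + (1 - t) • y ∈ ballLevelSet μ β (t * v + (1 - t) * w) := by
  have ht' : 0 < 1 - t := sub_pos.2 ht1
  set ρ := t * v + (1 - t) * w with hρ
  have hρ0 : 0 < ρ := by positivity
  have tend : ∀ {a : ℝ}, 0 < a → Tendsto (fun r : ℝ => a * (r / ρ)) (𝓝[>] 0) (𝓝[>] 0) := by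
    intro a ha
    refine tendsto_nhdsWithin_iff.2 ⟨?_, ?_⟩
    · have : Tendsto (fun r : ℝ => a * (r / ρ)) (𝓝 0) (𝓝 (a * (0 / ρ))) :=
        Continuous.tendsto (by fun_prop) _
      rw [zero_div, mul_zero] at this
      exact this.mono_left nhdsWithin_le_nhds
    · filter_upwards [self_mem_nhdsWithin] with r (hr : 0 < r)
      exact mul_pos ha (div_pos hr hρ0)
  filter_upwards [(tend hv).eventually hx, (tend hw).eventually hy, self_mem_nhdsWithin]
    with r h1 h2 (hr : 0 < r)
  set s := r / ρ with hs
  have hs0 : 0 < s := div_pos hr hρ0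
  set c := volume.real (closedBall (0 : EuclideanSpace ℝ (Fin n)) 1) with hc
  have hc0 : 0 < c := volume_real_closedBall_pos
  have hγ : 0 < s ^ n * c := by positivity
  have e : ∀ {a : ℝ}, 0 < a → ∀ x : EuclideanSpace ℝ (Fin n),
      a ^ (-β) * volume.real (closedBall x (a * s)) = a ^ (1 / κ) * (s ^ n * c) := by
    intro a ha x
    have : 1 / κ = -β + n := by rw [hβ]; ring
    rw [volume_real_closedBall x (by positivity), this, Real.rpow_add_natCast ha.ne', mul_pow]
    ring
  rw [e hv] at h1
  rw [e hw] at h2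
  have hr' : r = ρ * s := by rw [hs]; field_simp
  have hball : closedBall (t • x + (1 - t) • y) r
      = t • closedBall x (v * s) + (1 - t) • closedBall y (w * s) := by
    rw [_root_.smul_closedBall _ _ (by positivity), _root_.smul_closedBall _ _ (by positivity),
      closedBall_add_closedBall (by positivity) (by positivity), Real.norm_of_nonneg ht.le,
      Real.norm_of_nonneg ht'.le, hr', hρ]
    congr 1; ring
  have pos : ∀ {a : ℝ} {A : Set (EuclideanSpace ℝ (Fin n))}, 0 < a →
      a ^ (1 / κ) * (s ^ n * c) ≤ μ.real A → 0 < μ A := fun ha h => by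
    have := (mul_pos (Real.rpow_pos_of_pos ha (1 / κ)) hγ).trans_le h
    exact (ENNReal.toReal_pos_iff.1 this).1
  have h3 := hμ t ht ht1 _ _ (measurableSet_closedBall (x := x) (ε := v * s))
    (measurableSet_closedBall (x := y) (ε := w * s)) (pos hv h1) (pos hw h2)
  have h4 := powerMean_scaled_le hκ ht ht1 hv hw hγ h1 h2
  rw [← hball] at h3
  calc ρ ^ (-β) * volume.real (closedBall (t • x + (1 - t) • y) r)
      = ρ ^ (1 / κ) * (s ^ n * c) := by rw [hr']; exact e hρ0 _
    _ ≤ _ := h4.trans h3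

lemma IsKappaConcave.pow_mul_volume_ballLevelSet_le {μ : Measure (EuclideanSpace ℝ (Fin n))}
    {κ : ℝ} (hμ : IsKappaConcave κ μ) (hκ : κ < 0) (hβ : β = n - 1 / κ)
    {v u t : ℝ} (hv : 0 < v) (hu : 0 < u) (ht : 0 < t) (ht1 : t < 1)
    {x : EuclideanSpace ℝ (Fin n)} (hx : x ∈ ballLevelSet μ β v) :
    ENNReal.ofReal (t ^ n) * volume (ballLevelSet μ β (v + u)) ≤
      volume (ballLevelSet μ β (v + t * u)) := by
  have hsub : (fun z => z + (1 - t) • x) '' (t • ballLevelSet μ β (v + u)) ⊆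
      ballLevelSet μ β (v + t * u) := by
    rintro _ ⟨_, ⟨z, hz, rfl⟩, rfl⟩
    have := hμ.combo_mem_ballLevelSet hκ hβ (by linarith) hv ht ht1 hz hx
    convert this using 2
    ring
  have h := measure_mono (μ := volume) hsub
  rwa [Set.image_add_right, measure_preimage_add_right, Measure.addHaar_smul,
    finrank_euclideanSpace_fin, abs_of_nonneg (by positivity)] at h

/-- Besicovitch differentiation, with one null set serving all `v`. Equality of density and level is
left undecided, hence the strict inequality in one direction. -/
lemma ae_ballLevelSet_iff (μ : Measure (EuclideanSpace ℝ (Fin n))) [IsFiniteMeasure μ] :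
    ∀ᵐ x, ∀ v : ℝ,
      (v ^ (-β) < (μ.rnDeriv volume x).toReal → x ∈ ballLevelSet μ β v) ∧
      (x ∈ ballLevelSet μ β v → v ^ (-β) ≤ (μ.rnDeriv volume x).toReal) := by
  filter_upwards [Besicovitch.ae_tendsto_rnDeriv μ volume, μ.rnDeriv_lt_top volume] with x hx hfin v
  have h : Tendsto (fun r => μ.real (closedBall x r) / volume.real (closedBall x r)) (𝓝[>] 0)
      (𝓝 (μ.rnDeriv volume x).toReal) := by
    refine ((ENNReal.tendsto_toReal hfin.ne).comp hx).congr fun r => ?_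
    simp [Measure.real, ENNReal.toReal_div]
  have hpos : ∀ᶠ r in 𝓝[>] (0 : ℝ), 0 < volume.real (closedBall x r) := by
    filter_upwards [self_mem_nhdsWithin] with r (hr : 0 < r)
    exact ENNReal.toReal_pos (measure_closedBall_pos volume x hr).ne' measure_closedBall_lt_top.ne
  constructor
  · intro hv
    filter_upwards [h.eventually (lt_mem_nhds hv), hpos] with r h1 h2
    exact ((lt_div_iff₀ h2).1 h1).le
  · intro hv
    refine ge_of_tendsto h ?_
    filter_upwards [hv, hpos] with r h1 h2
    exact (le_div_iff₀ h2).2 h1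

lemma IsKappaConcave.volume_superlevel_mul_le {μ : Measure (EuclideanSpace ℝ (Fin n))}
    [IsFiniteMeasure μ] {κ : ℝ} (hμ : IsKappaConcave κ μ) (hκ : κ < 0) (hβ : β = n - 1 / κ)
    (hβ0 : 0 < β) {M : ℝ} (hM0 : 0 < M)
    (hM : volume {x | M < (μ.rnDeriv volume x).toReal} ≠ 0)
    {y z : ℝ} (hy : 0 < y) (hyz : y ≤ z) (hz : z < 1) :
    volume.real {x | M * y ≤ (μ.rnDeriv volume x).toReal} * extremalProfile n β z ≤
      volume.real {x | M * z ≤ (μ.rnDeriv volume x).toReal} * extremalProfile n β y := by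
  have hfi : Integrable (fun x => (μ.rnDeriv volume x).toReal) := Measure.integrable_toReal_rnDeriv
  have hfin : ∀ {a : ℝ}, 0 < a → volume {x | a ≤ (μ.rnDeriv volume x).toReal} < ∞ :=
    fun ha => hfi.measure_ge_lt_top ha
  have hae := ae_ballLevelSet_iff (β := β) μ
  have hroot : ∀ {a : ℝ}, 0 < a → (a ^ (-1 / β)) ^ (-β) = a := fun ha => by
    rw [← Real.rpow_mul ha.le, neg_div, neg_mul_neg, one_div_mul_cancel hβ0.ne', Real.rpow_one]
  set v := M ^ (-1 / β) with hv
  have hv0 : 0 < v := Real.rpow_pos_of_pos hM0 _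
  obtain ⟨x, hx⟩ : ∃ x, x ∈ ballLevelSet μ β v := by
    by_contra hne
    push Not at hne
    refine hM (measure_eq_zero_iff_ae_notMem.2 ?_)
    filter_upwards [hae] with x hx hxM
    exact hne x ((hx v).1 (by rw [hroot hM0]; exact hxM))
  have hz0 : 0 < z := hy.trans_le hyz
  set a := y ^ (-1 / β) - 1 with ha
  set b := z ^ (-1 / β) - 1 with hb
  have hneg : -1 / β < 0 := div_neg_of_neg_of_pos (by norm_num) hβ0
  have hb0 : 0 < b := sub_pos.2 (Real.one_lt_rpow_of_pos_of_lt_one_of_neg hz0 hz hneg)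
  have hab : b ≤ a := sub_le_sub_right (Real.rpow_le_rpow_of_nonpos hy hyz hneg.le) 1
  -- Taking `u > a` supplies the strict inequality needed to enter `ballLevelSet`; letting `u`
  -- decrease to `a` removes the loss.
  have key : ∀ u, a < u →
      volume.real {x | M * y ≤ (μ.rnDeriv volume x).toReal} * b ^ n ≤
      volume.real {x | M * z ≤ (μ.rnDeriv volume x).toReal} * u ^ n := by
    intro u hu
    have hu0 : 0 < u := (hb0.trans_le hab).trans hu
    have h1 : volume {x | M * y ≤ (μ.rnDeriv volume x).toReal} ≤
        volume (ballLevelSet μ β (v + v * u)) := by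
      refine measure_mono_ae ?_
      filter_upwards [hae] with x hx (hxy : M * y ≤ _)
      refine (hx _).1 (lt_of_lt_of_le ?_ hxy)
      rw [← hroot (mul_pos hM0 hy)]
      refine Real.rpow_lt_rpow_of_neg (by positivity) ?_ (by linarith)
      rw [Real.mul_rpow hM0.le hy.le]
      have : y ^ (-1 / β) < 1 + u := by linarith
      nlinarith
    have h2 : volume (ballLevelSet μ β (v + v * b)) ≤
        volume {x | M * z ≤ (μ.rnDeriv volume x).toReal} := by
      refine measure_mono_ae ?_
      filter_upwards [hae] with x hx hxL
      have := (hx _).2 hxL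
      have e : v + v * b = (M * z) ^ (-1 / β) := by
        rw [Real.mul_rpow hM0.le hz0.le, hb]; ring
      rwa [e, hroot (mul_pos hM0 hz0)] at this
    -- The contraction ratio `b / u` carries the level `v + v u` to `v + v b`.
    have h3 := hμ.pow_mul_volume_ballLevelSet_le hκ hβ hv0 (mul_pos hv0 hu0) (div_pos hb0 hu0)
      ((div_lt_one hu0).2 (hab.trans_lt hu)) hx
    have e : v + b / u * (v * u) = v + v * b := by field_simp
    rw [e] at h3
    have h4 := ((mul_le_mul_right h1 (ENNReal.ofReal ((b / u) ^ n))).trans h3).trans h2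
    have h5 := ENNReal.toReal_mono (hfin (mul_pos hM0 hz0)).ne h4
    rw [ENNReal.toReal_mul, ENNReal.toReal_ofReal (by positivity), div_pow,
      div_mul_eq_mul_div, div_le_iff₀ (by positivity)] at h5
    rw [mul_comm]
    exact h5
  have hlim : Tendsto (fun u : ℝ =>
      volume.real {x | M * z ≤ (μ.rnDeriv volume x).toReal} * u ^ n) (𝓝[>] a)
      (𝓝 (volume.real {x | M * z ≤ (μ.rnDeriv volume x).toReal} * a ^ n)) :=
    (Continuous.tendsto (by fun_prop) a).mono_left nhdsWithin_le_nhds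
  refine ge_of_tendsto hlim ?_
  filter_upwards [self_mem_nhdsWithin] with u hu using key u hu
end

/-! ### Entropy of truncations and the two entropy bounds. -/

section
variable {α : Type*} [MeasurableSpace α] {μ : Measure α} {f : α → ℝ} {n : ℕ} {β : ℝ}

/-- The absolute value keeps the layer-cake weight nonnegative on the whole half-line; the extra
term `a` is why `entropyConst n β - 1` appears later. -/
lemma integral_abs_log_zero_left {a : ℝ} (h0 : 0 ≤ a) (h1 : a ≤ 1) :
    ∫ y in (0 : ℝ)..a, |Real.log y| = a - a * Real.log a := by
  have : ∫ y in (0 : ℝ)..a, |Real.log y| = ∫ y in (0 : ℝ)..a, -Real.log y := by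
    refine intervalIntegral.integral_congr fun y hy => ?_
    rw [Set.uIcc_of_le h0] at hy
    exact abs_of_nonpos (Real.log_nonpos hy.1 (hy.2.trans h1))
  rw [this, intervalIntegral.integral_neg, integral_log_from_zero]
  ring

/-- If the level-set profile of `f` below the height `M` grows relative to the extremal one, then
the truncation `min (f / M) 1` has the entropy bound of the extremal density. -/
theorem integral_neg_truncation_mul_log_le (hn : n < β) (hf : Measurable f) (hf0 : ∀ x, 0 ≤ f x)
    (hfi : Integrable f μ) {M : ℝ} (hM : 0 < M)
    (hmono : ∀ y z, 0 < y → y ≤ z → z < 1 →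
      μ.real {x | M * y ≤ f x} * extremalProfile n β z ≤
        μ.real {x | M * z ≤ f x} * extremalProfile n β y) :
    Integrable (fun x => min (f x / M) 1 * Real.log (min (f x / M) 1)) μ ∧
    ∫ x, -(min (f x / M) 1 * Real.log (min (f x / M) 1)) ∂μ ≤
      (entropyConst n β - 1) * ∫ x, min (f x / M) 1 ∂μ := by
  set H : α → ℝ := fun x => min (f x / M) 1 with hH
  have hHm : Measurable H := (hf.div_const M).min measurable_const
  have hH0 : ∀ x, 0 ≤ H x := fun x => le_min (div_nonneg (hf0 x) hM.le) zero_le_one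
  have hH1 : ∀ x, H x ≤ 1 := fun x => min_le_right _ _
  have hHi : Integrable H μ := by
    refine Integrable.mono' (hfi.div_const M) hHm.aestronglyMeasurable
      (Filter.Eventually.of_forall fun x => ?_)
    rw [Real.norm_of_nonneg (hH0 x)]
    exact min_le_left _ _
  set D : ℝ → ℝ := fun y => μ.real {x | M * y ≤ f x} with hD
  have hset : ∀ y, y ≤ 1 → {x | y ≤ H x} = {x | M * y ≤ f x} := fun y hy => by
    ext x
    simp [hH, le_div_iff₀ hM, hy, mul_comm]
  have hset' : ∀ y, 1 < y → {x | y ≤ H x} = ∅ := fun y hy => by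
    ext x
    simpa using (hH1 x).trans_lt hy
  have hfin : ∀ y, 0 < y → μ {x | M * y ≤ f x} ≠ ∞ := fun y hy =>
    (hfi.measure_ge_lt_top (mul_pos hM hy)).ne
  have hanti : AntitoneOn D (Set.Ioc 0 1) := fun y hy z _ hyz =>
    measureReal_mono (fun x (hx : M * z ≤ f x) =>
      (mul_le_mul_of_nonneg_left hyz hM.le).trans hx) (hfin y hy.1)
  obtain ⟨-, hL, hle⟩ := integral_neg_log_mul_le hn (fun y => measureReal_nonneg) hanti hmono
  have hHint : ∫ x, H x ∂μ = ∫ y in Set.Ioc 0 1, D y := by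
    rw [hHi.integral_eq_integral_Ioc_meas_le (M := 1) (Filter.Eventually.of_forall hH0)
      (Filter.Eventually.of_forall hH1)]
    exact setIntegral_congr_fun measurableSet_Ioc fun y hy => by
      simp only [hD]; rw [hset y hy.2]
  have hN0 : ∀ x, 0 ≤ H x - H x * Real.log (H x) := fun x => by
    have := mul_nonpos_of_nonneg_of_nonpos (hH0 x) (Real.log_nonpos (hH0 x) (hH1 x))
    linarith [hH0 x]
  have hNm : Measurable fun x => H x - H x * Real.log (H x) := by fun_prop
  have hlayer : ∫⁻ x, ENNReal.ofReal (H x - H x * Real.log (H x)) ∂μ =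
      ENNReal.ofReal (∫ y in Set.Ioc 0 1, -Real.log y * D y) := by
    have h1 := lintegral_comp_eq_lintegral_meas_le_mul μ (g := fun y => |Real.log y|)
      (Filter.Eventually.of_forall hH0) hHm.aemeasurable
      (fun t _ => intervalIntegral.intervalIntegrable_log'.abs)
      (Filter.Eventually.of_forall fun y => abs_nonneg _)
    simp_rw [fun x => integral_abs_log_zero_left (hH0 x) (hH1 x)] at h1
    rw [h1, ofReal_integral_eq_lintegral_ofReal hL]
    · have h2 : ∀ y ∈ Set.Ioi (0 : ℝ), μ {x | y ≤ H x} * ENNReal.ofReal |Real.log y| =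
          (Set.Ioc (0 : ℝ) 1).indicator (fun y => ENNReal.ofReal (-Real.log y * D y)) y := by
        intro y hy
        rcases le_or_gt y 1 with hy1 | hy1
        · rw [Set.indicator_of_mem (show y ∈ Set.Ioc (0 : ℝ) 1 from ⟨hy, hy1⟩), hset y hy1,
            abs_of_nonpos (Real.log_nonpos (le_of_lt hy) hy1), mul_comm (-Real.log y),
            ENNReal.ofReal_mul measureReal_nonneg, measureReal_def,
            ENNReal.ofReal_toReal (hfin y hy)]
        · rw [Set.indicator_of_notMem fun h => absurd h.2 (not_le.2 hy1), hset' y hy1]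
          simp
      rw [setLIntegral_congr_fun measurableSet_Ioi h2, setLIntegral_indicator measurableSet_Ioc,
        Set.inter_eq_left.2 Set.Ioc_subset_Ioi_self]
    · filter_upwards [ae_restrict_mem measurableSet_Ioc] with y hy
      exact mul_nonneg (neg_nonneg.2 (Real.log_nonpos hy.1.le hy.2)) measureReal_nonneg
  have hR0 : 0 ≤ ∫ y in Set.Ioc 0 1, -Real.log y * D y :=
    setIntegral_nonneg measurableSet_Ioc fun y hy =>
      mul_nonneg (neg_nonneg.2 (Real.log_nonpos hy.1.le hy.2)) measureReal_nonneg
  have hNi : Integrable (fun x => H x - H x * Real.log (H x)) μ := by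
    refine ⟨hNm.aestronglyMeasurable, ?_⟩
    rw [hasFiniteIntegral_iff_ofReal (Filter.Eventually.of_forall hN0), hlayer]
    exact ENNReal.ofReal_lt_top
  have hNint : ∫ x, (H x - H x * Real.log (H x)) ∂μ = ∫ y in Set.Ioc 0 1, -Real.log y * D y := by
    rw [integral_eq_lintegral_of_nonneg_ae (Filter.Eventually.of_forall hN0)
      hNm.aestronglyMeasurable, hlayer, ENNReal.toReal_ofReal hR0]
  have hi : Integrable (fun x => H x * Real.log (H x)) μ := by
    refine (hHi.sub hNi).congr (Filter.Eventually.of_forall fun x => ?_)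
    simp
  refine ⟨hi, ?_⟩
  rw [integral_sub hHi hi] at hNint
  rw [integral_neg]
  rw [← hHint, ← hNint] at hle
  linarith

lemma exists_gt_measure_superlevel_ne_zero {a : ℝ} (h : μ {x | a < f x} ≠ 0) :
    ∃ b, a < b ∧ μ {x | b < f x} ≠ 0 := by
  by_contra hc
  push Not at hc
  refine h (measure_mono_null ?_ (measure_iUnion_null (s := fun k : ℕ =>
    {x | a + 1 / ((k : ℝ) + 1) < f x}) fun k => hc _ (by
      have : 0 < 1 / ((k : ℝ) + 1) := by positivity
      linarith)))
  intro x (hx : a < f x)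
  obtain ⟨k, hk⟩ := exists_nat_one_div_lt (sub_pos.2 hx)
  exact Set.mem_iUnion.2 ⟨k, by simp only [Set.mem_ofPred_eq]; linarith⟩

/-- Entropy bounds for a probability density whose truncations obey an entropy bound. -/
theorem entropy_bounds_of_truncation (hf : Measurable f) (hf0 : ∀ x, 0 ≤ f x)
    (hfi : Integrable f μ) (hf1 : ∫ x, f x ∂μ = 1) {C : ℝ} (hC : 0 ≤ C)
    (htr : ∀ M, 0 < M → μ {x | M < f x} ≠ 0 →
      Integrable (fun x => min (f x / M) 1 * Real.log (min (f x / M) 1)) μ ∧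
      ∫ x, -(min (f x / M) 1 * Real.log (min (f x / M) 1)) ∂μ ≤ C * ∫ x, min (f x / M) 1 ∂μ) :
    Integrable (fun x => f x * Real.log (f x)) μ ∧ Integrable (fun x => f x ^ 2) μ ∧
    0 < ∫ x, f x ^ 2 ∂μ ∧
    -∫ x, f x * Real.log (f x) ∂μ ≤ -Real.log (∫ x, f x ^ 2 ∂μ) + C ∧
    -Real.log (∫ x, f x ^ 2 ∂μ) ≤ -∫ x, f x * Real.log (f x) ∂μ := by
  have hne : μ {x | 0 < f x} ≠ 0 := by
    intro h
    have : ∫ x, f x ∂μ = 0 := integral_eq_zero_of_ae (by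
      filter_upwards [measure_eq_zero_iff_ae_notMem.1 h] with x hx
      exact le_antisymm (not_lt.1 hx) (hf0 x))
    linarith
  obtain ⟨a, ha0, ha⟩ := exists_gt_measure_superlevel_ne_zero hne
  -- the bound for the truncated entropy, in terms of `f`
  have hscaled : ∀ M, 0 < M → μ {x | M < f x} ≠ 0 →
      M * ∫ x, -(min (f x / M) 1 * Real.log (min (f x / M) 1)) ∂μ ≤ C := by
    intro M hM h
    have h1 := mul_le_mul_of_nonneg_left (htr M hM h).2 hM.le
    have h2 : M * ∫ x, min (f x / M) 1 ∂μ ≤ 1 := by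
      rw [← integral_const_mul]
      refine le_of_le_of_eq ?_ hf1
      refine integral_mono_of_nonneg (Filter.Eventually.of_forall fun x =>
        mul_nonneg hM.le (le_min (div_nonneg (hf0 x) hM.le) zero_le_one)) hfi
        (Filter.Eventually.of_forall fun x => ?_)
      calc M * min (f x / M) 1 ≤ M * (f x / M) := mul_le_mul_of_nonneg_left (min_le_left _ _) hM.le
        _ = f x := by field_simp
    nlinarith
  have hnonneg : ∀ {M : ℝ}, 0 < M → ∀ x, 0 ≤ -(min (f x / M) 1 * Real.log (min (f x / M) 1)) := by
    intro M hM x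
    have h0 : 0 ≤ min (f x / M) 1 := le_min (div_nonneg (hf0 x) hM.le) zero_le_one
    exact neg_nonneg.2 (mul_nonpos_of_nonneg_of_nonpos h0 (Real.log_nonpos h0 (min_le_right _ _)))
  have hpoint : ∀ {M : ℝ}, 0 < M → ∀ x, f x ≤ M →
      M * -(min (f x / M) 1 * Real.log (min (f x / M) 1)) = f x * Real.log M - f x * Real.log (f x) := by
    intro M hM x hx
    rw [min_eq_left ((div_le_one hM).2 hx)]
    rcases (hf0 x).eq_or_lt with h | h
    · simp [← h]
    · rw [Real.log_div h.ne' hM.ne']; field_simp; ring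
  -- `f` is essentially bounded
  obtain ⟨B, hB⟩ : ∃ B, ∀ᵐ x ∂μ, f x ≤ B := by
    obtain ⟨k, hk⟩ : ∃ k : ℕ, μ {x | a < f x ∧ f x ≤ k} ≠ 0 := by
      by_contra hc
      push Not at hc
      refine ha (measure_mono_null (fun x hx => ?_) (measure_iUnion_null hc))
      obtain ⟨k, hk⟩ := exists_nat_ge (f x)
      exact Set.mem_iUnion.2 ⟨k, hx, hk⟩
    set A := {x | a < f x ∧ f x ≤ k} with hA
    have hAm : MeasurableSet A := (measurableSet_lt measurable_const hf).inter
      (measurableSet_le hf measurable_const)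
    have hAfin : μ A ≠ ∞ := ne_top_of_le_ne_top (hfi.measure_ge_lt_top ha0).ne
      (measure_mono fun x hx => hx.1.le)
    have hAr : 0 < μ.real A := ENNReal.toReal_pos hk hAfin
    have hk0 : (0 : ℝ) < k := by
      obtain ⟨x, hx⟩ := nonempty_of_measure_ne_zero hk
      exact ha0.trans (hx.1.trans_le hx.2)
    -- For `M` above this value, `A` alone contributes at least `a μ(A) log (M / k) > C` to the
    -- scaled truncated entropy, contradicting `hscaled`.
    refine ⟨k * Real.exp (C / (a * μ.real A)), ?_⟩
    by_contra hc
    have hc' : μ {x | k * Real.exp (C / (a * μ.real A)) < f x} ≠ 0 := by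
      intro h; apply hc
      filter_upwards [measure_eq_zero_iff_ae_notMem.1 h] with x hx using not_lt.1 hx
    obtain ⟨M, hM, hMne⟩ := exists_gt_measure_superlevel_ne_zero hc'
    have hkM : (k : ℝ) < M := by
      refine lt_of_le_of_lt ?_ hM
      exact le_mul_of_one_le_right hk0.le (Real.one_le_exp (by positivity))
    have hM0 : 0 < M := hk0.trans hkM
    have h1 := hscaled M hM0 hMne
    rw [← integral_const_mul] at h1
    have hi := ((htr M hM0 hMne).1.neg).const_mul M
    have h2 : ∫ x in A, a * Real.log (M / k) ∂μ ≤
        ∫ x in A, M * -(min (f x / M) 1 * Real.log (min (f x / M) 1)) ∂μ := by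
      refine setIntegral_mono_on (integrableOn_const hAfin) hi.integrableOn hAm fun x hx => ?_
      have hx0 : 0 < f x := ha0.trans hx.1
      rw [hpoint hM0 x (hx.2.trans hkM.le), ← mul_sub, Real.log_div hM0.ne' hk0.ne']
      have h3 : Real.log (f x) ≤ Real.log k := Real.log_le_log hx0 hx.2
      have h4 : Real.log k < Real.log M := Real.log_lt_log hk0 hkM
      exact mul_le_mul hx.1.le (by linarith) (by linarith) hx0.le
    have h3 : ∫ x in A, M * -(min (f x / M) 1 * Real.log (min (f x / M) 1)) ∂μ ≤
        ∫ x, M * -(min (f x / M) 1 * Real.log (min (f x / M) 1)) ∂μ :=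
      setIntegral_le_integral hi (Filter.Eventually.of_forall fun x =>
        mul_nonneg hM0.le (hnonneg hM0 x))
    rw [setIntegral_const, smul_eq_mul] at h2
    have h4 : C / (a * μ.real A) < Real.log (M / k) := by
      rw [Real.lt_log_iff_exp_lt (by positivity), lt_div_iff₀ hk0]; linarith
    rw [div_lt_iff₀ (by positivity)] at h4
    linarith
  have hlogm : Measurable fun x => f x * Real.log (f x) := by fun_prop
  -- Where `f ≤ a` the truncated entropy at height `a` controls `f log f`; where `a < f ≤ B` the
  -- logarithm is bounded.
  have hent : Integrable (fun x => f x * Real.log (f x)) μ := by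
    refine Integrable.mono' (((htr a ha0 ha).1.neg.const_mul a).add
      (hfi.mul_const (|Real.log a| + |Real.log B|))) hlogm.aestronglyMeasurable ?_
    filter_upwards [hB] with x hx
    simp only [Pi.add_apply, Pi.neg_apply]
    rw [Real.norm_eq_abs, abs_mul, abs_of_nonneg (hf0 x)]
    have hn := mul_nonneg ha0.le (hnonneg ha0 x)
    rcases le_or_gt (f x) a with h | h
    · have e := hpoint ha0 x h
      rw [e] at hn ⊢
      have h1 : |f x * Real.log (f x)| ≤
          (f x * Real.log a - f x * Real.log (f x)) + |f x * Real.log a| := by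
        have h2 := le_abs_self (f x * Real.log a)
        have h3 := neg_abs_le (f x * Real.log a)
        rw [abs_le]; constructor <;> linarith
      rw [abs_mul, abs_mul, abs_of_nonneg (hf0 x)] at h1
      have := mul_nonneg (hf0 x) (abs_nonneg (Real.log B))
      linarith
    · have hx0 := ha0.trans h
      have h1 : |Real.log (f x)| ≤ |Real.log a| + |Real.log B| := by
        have h2 := Real.log_le_log ha0 h.le
        have h3 := Real.log_le_log hx0 hx
        rw [abs_le]
        constructor
        · linarith [neg_abs_le (Real.log a), abs_nonneg (Real.log B)]
        · linarith [le_abs_self (Real.log B), abs_nonneg (Real.log a)]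
      have := mul_le_mul_of_nonneg_left h1 hx0.le
      linarith
  set h := -∫ x, f x * Real.log (f x) ∂μ with hh
  -- Pointwise `f log (M / f)` is at most the scaled truncated integrand, with equality for `f ≤ M`
  -- and a negative left side for `f > M`.
  have hsup : ∀ M, 0 < M → μ {x | M < f x} ≠ 0 → Real.log M + h ≤ C := by
    intro M hM hne
    refine le_trans ?_ (hscaled M hM hne)
    have e : Real.log M + h = ∫ x, (f x * Real.log M - f x * Real.log (f x)) ∂μ := by
      rw [integral_sub (hfi.mul_const _) hent, integral_mul_const, hf1]; ring
    rw [e, ← integral_const_mul]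
    refine integral_mono ((hfi.mul_const _).sub hent) ((htr M hM hne).1.neg.const_mul M) fun x => ?_
    rcases le_or_gt (f x) M with hx | hx
    · exact (hpoint hM x hx).ge
    · have h1 := Real.log_lt_log hM hx
      have h2 := mul_nonneg hM.le (hnonneg hM x)
      have h3 := mul_nonneg (hf0 x) (sub_nonneg.2 h1.le)
      linarith
  have hle : ∀ᵐ x ∂μ, f x ≤ Real.exp (C - h) := by
    by_contra hc
    have hc' : μ {x | Real.exp (C - h) < f x} ≠ 0 := by
      intro h0; apply hc
      filter_upwards [measure_eq_zero_iff_ae_notMem.1 h0] with x hx using not_lt.1 hx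
    obtain ⟨M, hM, hMne⟩ := exists_gt_measure_superlevel_ne_zero hc'
    have hM0 := (Real.exp_pos _).trans hM
    have h1 := hsup M hM0 hMne
    have h2 := (Real.lt_log_iff_exp_lt hM0).2 hM
    linarith
  have hsqle : ∀ᵐ x ∂μ, f x ^ 2 ≤ Real.exp (C - h) * f x := by
    filter_upwards [hle] with x hx
    rw [sq]; exact mul_le_mul_of_nonneg_right hx (hf0 x)
  have hsq : Integrable (fun x => f x ^ 2) μ := by
    refine Integrable.mono' (hfi.const_mul (Real.exp (C - h)))
      (hf.pow_const 2).aestronglyMeasurable ?_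
    filter_upwards [hsqle] with x hx
    rwa [Real.norm_of_nonneg (sq_nonneg _)]
  have hsqint : ∫ x, f x ^ 2 ∂μ ≤ Real.exp (C - h) := by
    have := integral_mono_ae hsq (hfi.const_mul (Real.exp (C - h))) hsqle
    rwa [integral_const_mul, hf1, mul_one] at this
  have hpos : 0 < ∫ x, f x ^ 2 ∂μ := by
    rw [integral_pos_iff_support_of_nonneg (fun x => sq_nonneg _) hsq]
    refine lt_of_lt_of_le (pos_iff_ne_zero.2 hne) (measure_mono fun x (hx : 0 < f x) => ?_)
    exact pow_ne_zero 2 hx.ne'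
  refine ⟨hent, hsq, hpos, ?_, ?_⟩
  · have := Real.log_le_log hpos hsqint
    rw [Real.log_exp] at this
    linarith
  · set S := ∫ x, f x ^ 2 ∂μ with hS
    -- Use `log s ≤ s - 1` at `s = f / S`, weighted by `f`; the error `f² / S - f` integrates to
    -- zero.
    have h1 : ∫ x, f x * Real.log (f x) ∂μ ≤
        ∫ x, (f x ^ 2 / S - f x + f x * Real.log S) ∂μ := by
      refine integral_mono hent (((hsq.div_const S).sub hfi).add (hfi.mul_const _)) fun x => ?_
      rcases (hf0 x).eq_or_lt with hx | hx
      · simp [← hx]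
      · have h2 := Real.log_le_sub_one_of_pos (div_pos hx hpos)
        rw [Real.log_div hx.ne' hpos.ne'] at h2
        have h3 := mul_le_mul_of_nonneg_left h2 hx.le
        have e : f x ^ 2 / S = f x * (f x / S) := by ring
        simp only [e]
        linarith
    have h2 : Integrable (fun x => f x ^ 2 / S - f x) μ := (hsq.div_const S).sub hfi
    rw [integral_add h2 (hfi.mul_const _),
      integral_sub (hsq.div_const S) hfi, integral_div, integral_mul_const, hf1,
      div_self hpos.ne'] at h1
    linarith
end

/-! ### Plancherel's theorem and characteristic functions. -/

section
open SchwartzMap FourierTransform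
open scoped ContDiff

variable {E : Type*} [NormedAddCommGroup E] [InnerProductSpace ℝ E] [FiniteDimensional ℝ E]
  [MeasurableSpace E] [BorelSpace E]

/-- On `L¹ ∩ L²` the `L²` Fourier transform is given by the Fourier integral. -/
theorem MeasureTheory.Lp.fourier_toLp_ae_eq {f : E → ℂ} (hf : Integrable f) (hf2 : MemLp f 2) :
    ⇑(𝓕 (hf2.toLp f) : Lp (α := E) ℂ 2) =ᵐ[volume] 𝓕 f := by
  have hcont : Continuous (𝓕 f) :=
    VectorFourier.fourierIntegral_continuous Real.continuous_fourierChar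
      (by exact continuous_inner) hf
  -- Both sides are tested against smooth compactly supported functions; in each pairing the
  -- transform moves onto the test function.
  refine ae_eq_of_integral_contDiff_smul_eq
    ((Lp.memLp _).locallyIntegrable (by norm_num)) hcont.locallyIntegrable fun g hg hgc => ?_
  have hg1 : ContDiff ℝ ∞ (fun x => (g x : ℂ)) := Complex.ofRealCLM.contDiff.comp hg
  have hg2 : HasCompactSupport (fun x => (g x : ℂ)) := hgc.comp_left Complex.ofReal_zero
  set φ : 𝓢(E, ℂ) := hg2.toSchwartzMap hg1 with hφ
  have h1 := congrArg (fun T => T φ) (Lp.fourier_toTemperedDistribution_eq (hf2.toLp f))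
  simp only [TemperedDistribution.fourier_apply, Lp.toTemperedDistribution_apply] at h1
  have h2 : ∫ x, (𝓕 f) x • φ x = ∫ x, f x • (𝓕 (φ : E → ℂ)) x := by
    have := VectorFourier.integral_fourierIntegral_smul_eq_flip (μ := (volume : Measure E))
      (ν := (volume : Measure E)) (L := innerₗ E) (e := Real.fourierChar) (f := f) (g := φ)
      Real.continuous_fourierChar continuous_inner hf φ.integrable
    rwa [flip_innerₗ] at this
  have h3 : ∫ x, (𝓕 φ) x • (hf2.toLp f) x = ∫ x, f x • (𝓕 (φ : E → ℂ)) x := by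
    refine integral_congr_ae ?_
    filter_upwards [hf2.coeFn_toLp] with x hx
    rw [hx, fourier_coe, smul_eq_mul, smul_eq_mul, mul_comm]
  rw [h3, ← h2] at h1
  convert! h1.symm using 2
  ext x
  simp [hφ, mul_comm]

lemma MeasureTheory.MemLp.norm_toLp_sq {F : Type*} [NormedAddCommGroup F] [InnerProductSpace ℂ F]
    {f : E → F} (hf : MemLp f 2) : ‖hf.toLp f‖ ^ 2 = ∫ x, ‖f x‖ ^ 2 := by
  have h := L2.inner_def (𝕜 := ℂ) (hf.toLp f) (hf.toLp f)
  rw [inner_self_eq_norm_sq_to_K] at h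
  have h2 : ∫ x, inner ℂ (hf.toLp f x) (hf.toLp f x) = ((∫ x, ‖f x‖ ^ 2 : ℝ) : ℂ) := by
    rw [← integral_complex_ofReal]
    refine integral_congr_ae ?_
    filter_upwards [hf.coeFn_toLp] with x hx
    rw [hx, inner_self_eq_norm_sq_to_K]
    norm_cast
  rw [h2] at h
  exact Complex.ofReal_injective (by simpa using h)

/-- Plancherel's theorem for the Fourier integral on `L¹ ∩ L²`. -/
theorem Real.plancherel {f : E → ℂ} (hf : Integrable f) (hf2 : MemLp f 2) :
    MemLp (𝓕 f) 2 ∧ ∫ x, ‖𝓕 f x‖ ^ 2 = ∫ x, ‖f x‖ ^ 2 := by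
  have h := Lp.fourier_toLp_ae_eq hf hf2
  have hm : MemLp (𝓕 f) 2 := (memLp_congr_ae h).1 (Lp.memLp _)
  refine ⟨hm, ?_⟩
  rw [← hm.norm_toLp_sq, ← hf2.norm_toLp_sq, ← Lp.norm_fourier_eq (hf2.toLp f)]
  congr 2
  exact Lp.ext (hm.coeFn_toLp.trans h.symm)

/-- Plancherel's theorem for the characteristic function of a measure with a density in `L²`. -/
theorem MeasureTheory.charFun_plancherel {μ : Measure E} {f : E → ℝ} (hf0 : ∀ x, 0 ≤ f x)
    (hfm : Measurable f) (hf : Integrable f) (hf2 : MemLp f 2) [IsFiniteMeasure μ]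
    (hμ : μ = volume.withDensity fun x => ENNReal.ofReal (f x)) :
    MemLp (charFun μ) 2 ∧
    ∫ t, ‖charFun μ t‖ ^ 2 = (2 * Real.pi) ^ Module.finrank ℝ E * ∫ x, f x ^ 2 := by
  obtain ⟨h1, h2⟩ := Real.plancherel (f := fun x => (f x : ℂ)) hf.ofReal hf2.ofReal
  -- Passing from `e^(-2πi⟨x,ξ⟩)` to `e^(i⟨x,t⟩)` rescales by `-1/(2π)`, whose Jacobian gives the
  -- power of `2π`.
  have hchar : ∀ t, charFun μ t = 𝓕 (fun x => (f x : ℂ)) ((-(2 * Real.pi)⁻¹ : ℝ) • t) := by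
    intro t
    rw [charFun_apply, hμ, integral_withDensity_eq_integral_toReal_smul (by fun_prop)
      (Filter.Eventually.of_forall fun x => ENNReal.ofReal_lt_top), Real.fourier_eq']
    refine integral_congr_ae (Filter.Eventually.of_forall fun x => ?_)
    simp only [ENNReal.toReal_ofReal (hf0 x), inner_smul_right, Complex.real_smul, smul_eq_mul]
    rw [mul_comm]
    congr 3
    have := Real.pi_ne_zero
    push_cast
    field_simp
  have hne : (-(2 * Real.pi)⁻¹ : ℝ) ≠ 0 := neg_ne_zero.2 (by positivity)
  constructor
  · rw [memLp_two_iff_integrable_sq_norm measurable_charFun.aestronglyMeasurable]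
    simp_rw [hchar]
    exact (h1.integrable_norm_pow two_ne_zero).comp_smul hne
  · simp_rw [hchar]
    rw [Measure.integral_comp_smul volume (fun y => ‖𝓕 (fun x => (f x : ℂ)) y‖ ^ 2), h2]
    simp [abs_mul, abs_of_pos Real.pi_pos, mul_pow]
end

/-! ### Assembly of the theorem. -/

lemma entropyConst_sub_one {n : ℕ} {β : ℝ} (hβ : β ≠ 0) :
    entropyConst n β - 1 = β * ∑ i ∈ Finset.Icc 1 n, 1 / (β - (i : ℝ)) := by
  have : ∀ n : ℕ, ∑ i ∈ Finset.range (n + 1), 1 / (β - (i : ℝ)) =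
      1 / β + ∑ i ∈ Finset.Icc 1 n, 1 / (β - (i : ℝ)) := by
    intro n
    induction n with
    | zero => simp
    | succ n ih => rw [Finset.sum_range_succ, ih, Finset.sum_Icc_succ_top (by omega), add_assoc]
  rw [entropyConst, this, mul_add, mul_one_div_cancel hβ, add_sub_cancel_left]

theorem mainTheorem10 {Ω : Type*} [MeasurableSpace Ω] (P : Measure Ω) [IsProbabilityMeasure P]
    (n : ℕ) (X : Ω → EuclideanSpace ℝ (Fin n)) (hX : HasPDF X P volume)
    (κ β : ℝ) (hconc : IsKappaConcave κ (P.map X))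
    (hβ : β = (n : ℝ) - 1 / κ) (hβn : (n : ℝ) + 1 ≤ β) :
    Integrable (fun x => density P X x * Real.log (density P X x)) ∧
    MemLp (density P X) 2 ∧
    renyiEntropy 2 P X ≤ diffEntropy P X ∧
    diffEntropy P X ≤ renyiEntropy 2 P X + β * ∑ i ∈ Finset.Icc 1 n, 1 / (β - (i : ℝ)) ∧
    MemLp (charFun (P.map X)) 2 ∧
    renyiEntropy 2 P X =
      (n : ℝ) * Real.log (2 * Real.pi) - Real.log (∫ t, ‖charFun (P.map X) t‖ ^ 2) := by
  have hn : (n : ℝ) < β := by linarith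
  have hβ0 : 0 < β := lt_of_le_of_lt (Nat.cast_nonneg n) hn
  -- This also excludes `κ = 0`, where `1 / κ` is `0` by convention and `β` would equal `n`.
  have hκ : κ < 0 := by
    by_contra h
    have : 0 ≤ 1 / κ := one_div_nonneg.2 (not_lt.1 h)
    linarith
  set f := density P X with hf
  have hrn : ∀ x, f x = ((P.map X).rnDeriv volume x).toReal := fun x => by
    rw [hf, density, pdf_def]
  have hfm : Measurable f := (measurable_pdf X P volume).ennreal_toReal
  have hf0 : ∀ x, 0 ≤ f x := fun x => ENNReal.toReal_nonneg
  have hprob : IsProbabilityMeasure (P.map X) :=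
    Measure.isProbabilityMeasure_map (HasPDF.aemeasurable X P volume)
  have hfi : Integrable f := by
    simp_rw [funext hrn]
    exact Measure.integrable_toReal_rnDeriv
  have hμ : P.map X = volume.withDensity fun x => ENNReal.ofReal (f x) := by
    rw [map_eq_withDensity_pdf X P volume]
    refine withDensity_congr_ae ?_
    exact pdf.ofReal_toReal_ae_eq.symm
  have hf1 : ∫ x, f x = 1 := by
    simp_rw [hrn]
    rw [Measure.integral_toReal_rnDeriv HasPDF.absolutelyContinuous]
    simp
  have hC : 0 ≤ entropyConst n β - 1 := by
    rw [entropyConst_sub_one hβ0.ne']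
    refine mul_nonneg hβ0.le (Finset.sum_nonneg fun i hi => one_div_nonneg.2 ?_)
    have : (i : ℝ) ≤ n := by exact_mod_cast (Finset.mem_Icc.1 hi).2
    linarith
  obtain ⟨hent, hsq, hpos, hupper, hlower⟩ := entropy_bounds_of_truncation hfm hf0 hfi hf1 hC
    fun M hM hne => integral_neg_truncation_mul_log_le hn hfm hf0 hfi hM fun y z hy hyz hz => by
      simp_rw [hrn] at hne ⊢
      exact hconc.volume_superlevel_mul_le hκ hβ hβ0 hM hne hy hyz hz
  have hren : renyiEntropy 2 P X = -Real.log (∫ x, f x ^ 2) := by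
    rw [renyiEntropy, one_div, Real.log_inv, Real.log_rpow]
    · simp_rw [Real.rpow_two]
      norm_num
      simp [hf]
    · simpa only [Real.rpow_two] using hpos
  have hmem : MemLp f 2 := (memLp_two_iff_integrable_sq hfm.aestronglyMeasurable).2 hsq
  obtain ⟨hchar, hplan⟩ := charFun_plancherel hf0 hfm hfi hmem hμ
  rw [hren, ← entropyConst_sub_one hβ0.ne']
  refine ⟨hent, hmem, hlower, hupper, hchar, ?_⟩
  rw [hplan, finrank_euclideanSpace_fin, Real.log_mul (by positivity) hpos.ne', Real.log_pow]
  ring
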